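/- Let $\mathbb K=\mathbb R$ or $\mathbb C$, let $\mathfrak g$ be a finite-dimensional semisimple Lie algebra over $\mathbb K$ with basis $b_1,\dots,b_m$ and structure constants $[b_i,b_j]=\sum_k c_{ij}^k b_k$, and let $z_1,\dots,z_m$ be the corresponding linear coordinates on $\mathfrak g^*$, $z_i(\xi)=\xi(b_i)$. Equip $\mathfrak g^*$ with the Lie–Poisson bracket $\{f,g\}=\sum_{i,j,k}c_{ij}^k z_k\,\frac{\partial f}{\partial z_i}\frac{\partial g}{\partial z_j}$, and identify differentials at $0$ of functions on $\mathfrak g^*$ with elements of $\mathfrak g=(\mathfrak g^*)^*$. Let $h$ be a formal power series in $z_1,\dots,z_m$, or a $\mathbb K$-valued function on $\mathfrak g^*$ that is analytic near $0$ (identified with its Taylor series at $0$), such that $h(0)=0$ and $dh(0)\neq 0$. Then $X_h$ admits a formal Poincaré–Birkhoff normalization, in the following sense. The element $dh(0)\in\mathfrak g$ has a semisimple part $s\in\mathfrak g$, that is, $dh(0)=s+n$ with $\operatorname{ad}s$ semisimple, $\operatorname{ad}n$ nilpotent and $[s,n]=0$ (such an $s$ is unique). Moreover there is a formal coordinate system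 $\hat z_1,\dots,\hat z_m$ at $0$ (formal power series in $z_1,\dots,z_m$ without constant term and with invertible Jacobian matrix at $0$) in which the Poisson structure is linear, $\{\hat z_i,\hat z_j\}=\sum_k c_{ij}^k\hat z_k$ for all $i,j$, and in which $\{h,h_{ss}\}=0$, where $h_{ss}=\sum_i a_i\hat z_i$ $(a_i\in\mathbb K)$ is the function, linear in the coordinates $\hat z_i$, with $dh_{ss}(0)=s$. -/

import Mathlib

open scoped Nat

namespace LiePoisson

section Jordan

variable {𝕜 𝔤 : Type*} [Field 𝕜] [LieRing 𝔤] [LieAlgebra 𝕜 𝔤]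

variable (𝕜) in
/-- `s` is the semisimple part of `x` in the Lie algebra `𝔤` (abstract Jordan decomposition):
`x = s + n` with `ad s` semisimple, `ad n` nilpotent and `[s, n] = 0`. -/
def IsSemisimplePart (x s : 𝔤) : Prop :=
  ∃ n : 𝔤, x = s + n ∧ ⁅s, n⁆ = 0 ∧
    (LieAlgebra.ad 𝕜 𝔤 s).IsSemisimple ∧ IsNilpotent (LieAlgebra.ad 𝕜 𝔤 n)

/-- In a semisimple Lie algebra the semisimple part of an element is unique. -/
theorem IsSemisimplePart.unique [PerfectField 𝕜] [FiniteDimensional 𝕜 𝔤]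
    [LieAlgebra.IsSemisimple 𝕜 𝔤] {x s t : 𝔤}
    (hs : IsSemisimplePart 𝕜 x s) (ht : IsSemisimplePart 𝕜 x t) : s = t := by
  obtain ⟨n, hx, hsn, hss, hn⟩ := hs
  obtain ⟨m, hx', htm, hts, hm⟩ := ht
  have key : ∀ a c : 𝔤, ⁅a, c⁆ = 0 →
      Commute (LieAlgebra.ad 𝕜 𝔤 c) (LieAlgebra.ad 𝕜 𝔤 a) := by
    intro a c h
    refine LinearMap.ext fun y => ?_
    have := leibniz_lie a c y
    rw [h, zero_lie, zero_add] at this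
    simpa using this.symm
  have e : LieAlgebra.ad 𝕜 𝔤 n + LieAlgebra.ad 𝕜 𝔤 s
      = LieAlgebra.ad 𝕜 𝔤 m + LieAlgebra.ad 𝕜 𝔤 t := by
    rw [← map_add, ← map_add, add_comm n, add_comm m, ← hx, ← hx']
  have h := (Module.End.isNilpotent_isSemisimple_unique hn hss hm hts
    (key _ _ hsn) (key _ _ htm) e).2
  have hk : s - t ∈ LieAlgebra.center 𝕜 𝔤 := by
    refine (LieModule.mem_maxTrivSubmodule _ _ _ _).2 fun y => ?_
    have hy := LinearMap.congr_fun h y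
    simp only [LieAlgebra.ad_apply] at hy
    rw [← lie_skew, sub_lie, hy, sub_self, neg_zero]
  rw [LieAlgebra.center_eq_bot, LieSubmodule.mem_bot] at hk
  exact sub_eq_zero.1 hk

end Jordan

section Formal

variable {𝕜 𝔤 ι : Type*} [Field 𝕜] [LieRing 𝔤] [LieAlgebra 𝕜 𝔤] [Fintype ι]

/-! A basis `b` of `𝔤` is a system of linear coordinates `zᵢ(ξ) = ξ (b i)` on the dual `𝔤*`.
Formal functions on `𝔤*` are formal power series in these coordinates. -/

/-- The structure constants `c i j k` of `𝔤`: `[b i, b j] = ∑ k, c i j k • b k`. -/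
noncomputable def structConst (b : Module.Basis ι 𝕜 𝔤) (i j k : ι) : 𝕜 :=
  b.repr ⁅b i, b j⁆ k

/-- The Lie–Poisson bracket of formal functions on `𝔤*`:
`{f, g} = ∑ i j k, c i j k * z k * ∂f/∂z i * ∂g/∂z j`. -/
noncomputable def poissonBracket (b : Module.Basis ι 𝕜 𝔤) (f g : MvPowerSeries ι 𝕜) :
    MvPowerSeries ι 𝕜 :=
  ∑ i, ∑ j, ∑ k, structConst b i j k •
    (MvPowerSeries.X k * MvPowerSeries.pderiv 𝕜 i f * MvPowerSeries.pderiv 𝕜 j g)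

/-- The differential at the origin of a formal function on `𝔤*`, as an element of `𝔤 = 𝔤**`. -/
noncomputable def differentialAtZero (b : Module.Basis ι 𝕜 𝔤) (f : MvPowerSeries ι 𝕜) : 𝔤 :=
  ∑ i, MvPowerSeries.coeff (Finsupp.single i 1) f • b i

/-- A formal coordinate system at the origin: formal functions `ζ i` vanishing at `0` whose
Jacobian matrix at `0` is invertible. -/
def IsFormalCoordinateSystem [DecidableEq ι] (ζ : ι → MvPowerSeries ι 𝕜) : Prop :=
  (∀ i, MvPowerSeries.constantCoeff (ζ i) = 0) ∧
    IsUnit (Matrix.of fun i j => MvPowerSeries.coeff (Finsupp.single j 1) (ζ i)).det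

/-- The Lie–Poisson structure of `𝔤*` is linear in the formal functions `ζ`, with the structure
constants of `𝔤`. -/
def LinearizesPoisson (b : Module.Basis ι 𝕜 𝔤) (ζ : ι → MvPowerSeries ι 𝕜) : Prop :=
  ∀ i j, poissonBracket b (ζ i) (ζ j) = ∑ k, structConst b i j k • ζ k

/-- The Hamiltonian vector field of the formal function `h` on `𝔤*` admits a formal
Poincaré–Birkhoff normalization: the differential `dh(0) ∈ 𝔤` has a semisimple part `s`, and there
is a formal coordinate system in which the Poisson structure is linear and in which the linear
function `hss` with differential `s` satisfies `{h, hss} = 0`. -/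
def AdmitsFormalNormalization [DecidableEq ι] (b : Module.Basis ι 𝕜 𝔤)
    (h : MvPowerSeries ι 𝕜) : Prop :=
  ∃ s : 𝔤, IsSemisimplePart 𝕜 (differentialAtZero b h) s ∧
    ∃ ζ : ι → MvPowerSeries ι 𝕜, IsFormalCoordinateSystem ζ ∧ LinearizesPoisson b ζ ∧
      ∃ a : ι → 𝕜, differentialAtZero b (∑ i, a i • ζ i) = s ∧
        poissonBracket b h (∑ i, a i • ζ i) = 0

end Formal

section Analytic

variable {𝕜 𝔤 ι : Type*} [RCLike 𝕜] [LieRing 𝔤] [LieAlgebra 𝕜 𝔤] [Fintype ι] [DecidableEq ι]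

/-- The expression of a function on `𝔤*` in the coordinates `zᵢ(ξ) = ξ (b i)`. -/
noncomputable def inCoordinates (b : Module.Basis ι 𝕜 𝔤) (h : Module.Dual 𝕜 𝔤 → 𝕜) :
    (ι → 𝕜) → 𝕜 :=
  fun z => h (b.dualBasis.equivFun.symm z)

/-- The partial derivative of a function of several variables. -/
noncomputable def partialDeriv (i : ι) (f : (ι → 𝕜) → 𝕜) : (ι → 𝕜) → 𝕜 :=
  fun z => fderiv 𝕜 f z (Pi.single i 1)

/-- The iterated partial derivative `∂^α f`; for the analytic functions it is used on, the order
of the differentiations does not matter. -/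
noncomputable def iteratedPartialDeriv (α : ι →₀ ℕ) (f : (ι → 𝕜) → 𝕜) : (ι → 𝕜) → 𝕜 :=
  (Finsupp.toMultiset α).toList.foldr partialDeriv f

/-- The Taylor series at the origin, `∑ α, (1 / α!) * ∂^α f (0) * z^α`. -/
noncomputable def taylorSeries (f : (ι → 𝕜) → 𝕜) : MvPowerSeries ι 𝕜 :=
  fun α => (∏ i, ((α i)! : 𝕜))⁻¹ * iteratedPartialDeriv α f 0

end Analytic

end LiePoisson

/-! Put `x = dh(0) = s + n`. Grade formal functions so that weight `k` means homogeneous of degree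
`k + 1`; the Lie–Poisson bracket then adds weights. The aim is a formal Poisson automorphism `θ = ∑
θ k`, with `θ k` of weight `k` and `θ 0 = 1`, such that `{θ h, s} = 0`. With `ψ` its inverse, the
coordinates `ψ z_i` satisfy the linear relations, and `{h, ψ s} = ψ {θ h, s} = 0`.

The map `θ` is the flow at `t = 1` of a `t`-dependent Hamiltonian with coefficients `G k` of degree
`k + 2`. By the Jacobi identity each `{G k, ·}` is a derivation of the bracket, so `θ` preserves it
(`flow_bracket`). The generator `G k` first acts on `h` in weight `k + 1`, where it adds a multiple
of `{x, G k}`. Choosing the generators one at a time thus reduces to the homological equation: given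
homogeneous `v`, find `w` with `{s, v - {x, w}} = 0` (`exists_coadjoint_sub_eq_zero`).

That equation is linear algebra: `{x, ·}` is a sum of commuting semisimple and nilpotent operators
`S + N`, and `S (S + N)` has the same range as `S` (`exists_apply_sub_eq_zero`). All identities are
checked weight by weight, so no convergence question arises. -/

namespace LiePoisson

/-! ### Linear algebra: intertwiners and commuting semisimple plus nilpotent operators. -/

section LinearAlgebra

open Polynomial

variable {K V W : Type*} [Field K] [AddCommGroup V] [Module K V] [AddCommGroup W] [Module K W]

theorem pow_intertwines {f : V →ₗ[K] W} {A : Module.End K V} {B : Module.End K W}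
    (h : f ∘ₗ A = B ∘ₗ f) (k : ℕ) : f ∘ₗ (A ^ k) = (B ^ k) ∘ₗ f := by
  induction k with
  | zero => rfl
  | succ k ih =>
    rw [pow_succ', pow_succ', Module.End.mul_eq_comp, Module.End.mul_eq_comp,
      ← LinearMap.comp_assoc, h, LinearMap.comp_assoc, ih, LinearMap.comp_assoc]

theorem aeval_intertwines {f : V →ₗ[K] W} {A : Module.End K V} {B : Module.End K W}
    (h : f ∘ₗ A = B ∘ₗ f) (p : K[X]) : f ∘ₗ aeval A p = aeval B p ∘ₗ f := by
  ext v
  simp only [LinearMap.comp_apply, aeval_eq_sum_range, LinearMap.sum_apply, map_sum,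
    LinearMap.smul_apply, map_smul]
  exact Finset.sum_congr rfl fun i _ => by
    rw [show f ((A ^ i) v) = (B ^ i) (f v) from LinearMap.congr_fun (pow_intertwines h i) v]

/-- An injective intertwiner reflects semisimplicity. -/
theorem isSemisimple_of_injective_intertwines [FiniteDimensional K W] {f : V →ₗ[K] W}
    (hf : Function.Injective f) {A : Module.End K V} {B : Module.End K W}
    (h : f ∘ₗ A = B ∘ₗ f) (hB : B.IsSemisimple) : A.IsSemisimple := by
  refine Module.End.isSemisimple_of_squarefree_aeval_eq_zero hB.minpoly_squarefree ?_
  refine LinearMap.ext fun v => hf ?_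
  have := LinearMap.congr_fun (aeval_intertwines h (minpoly K B)) v
  simpa using this

/-- An injective intertwiner reflects nilpotency. -/
theorem isNilpotent_of_injective_intertwines {f : V →ₗ[K] W}
    (hf : Function.Injective f) {A : Module.End K V} {B : Module.End K W}
    (h : f ∘ₗ A = B ∘ₗ f) (hB : IsNilpotent B) : IsNilpotent A := by
  obtain ⟨k, hk⟩ := hB
  refine ⟨k, LinearMap.ext fun v => hf ?_⟩
  have := LinearMap.congr_fun (pow_intertwines h k) v
  simpa [hk] using this

/-- Algebra homomorphisms between endomorphism algebras preserve semisimplicity. -/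
theorem isSemisimple_map_algHom [FiniteDimensional K V]
    (Φ : Module.End K V →ₐ[K] Module.End K W) {A : Module.End K V} (hA : A.IsSemisimple) :
    (Φ A).IsSemisimple :=
  Module.End.isSemisimple_of_squarefree_aeval_eq_zero hA.minpoly_squarefree <| by
    rw [aeval_algHom_apply, minpoly.aeval, map_zero]

/-- If `S` is semisimple, `N` is nilpotent and both commute, then the equation
`(S + N) w = v` can be solved modulo the kernel of `S`. -/
theorem exists_apply_sub_eq_zero [FiniteDimensional K V] {S N : Module.End K V}
    (hS : S.IsSemisimple) (hN : IsNilpotent N) (hc : Commute N S) (v : V) :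
    ∃ w, S (v - (S + N) w) = 0 := by
  set T := S + N
  have hTS : S * T = T * S := by
    simp only [T, mul_add, add_mul, hc.eq]
  -- If `S T w = 0`, then `T` kills `S w`, so `S` acts on `S w` as `-N`. Hence a power of `S` kills
  -- `w`, and semisimplicity gives `S w = 0`.
  have hker : LinearMap.ker (S * T) ≤ LinearMap.ker S := by
    intro w hw
    rw [hTS, LinearMap.mem_ker, Module.End.mul_apply] at hw
    have h1 : S (S w) = (-N) (S w) := by
      simpa [T, add_eq_zero_iff_eq_neg] using hw
    have h2 : ∀ k, (S ^ k) (S w) = ((-N) ^ k) (S w) := by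
      intro k
      induction k with
      | zero => rfl
      | succ k ih =>
        have hc' : Commute (S ^ k) (-N) := (hc.symm.neg_right).pow_left k
        rw [pow_succ, Module.End.mul_apply, h1, ← Module.End.mul_apply, hc'.eq,
          Module.End.mul_apply, ih, pow_succ', Module.End.mul_apply]
    obtain ⟨k, hk⟩ := hN.neg
    have h3 : (S ^ (k + 1)) w = 0 := by
      rw [pow_succ, Module.End.mul_apply, h2, hk, LinearMap.zero_apply]
    have h4 := hS.isFinitelySemisimple.genEigenspace_eq_eigenspace 0 (k := ((k + 1 : ℕ) : ℕ∞))
      (by exact_mod_cast Nat.succ_pos k)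
    have h5 : w ∈ Module.End.genEigenspace S 0 ((k + 1 : ℕ) : ℕ∞) := by
      rw [Module.End.mem_genEigenspace_nat]
      simpa using h3
    rw [h4, Module.End.mem_eigenspace_iff, zero_smul] at h5
    exact h5
  have hle : LinearMap.range (S * T) ≤ LinearMap.range S := by
    rintro _ ⟨w, rfl⟩
    exact ⟨T w, rfl⟩
  -- Rank–nullity turns the kernel inclusion into equality of ranges.
  have hrange : LinearMap.range (S * T) = LinearMap.range S := by
    refine Submodule.eq_of_le_of_finrank_le hle ?_
    have h1 := LinearMap.finrank_range_add_finrank_ker (S * T)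
    have h2 := LinearMap.finrank_range_add_finrank_ker S
    have h3 := Submodule.finrank_mono hker
    omega
  obtain ⟨w, hw⟩ : S v ∈ LinearMap.range (S * T) := hrange ▸ ⟨v, rfl⟩
  exact ⟨w, by rw [map_sub, ← hw, Module.End.mul_apply, sub_self]⟩

end LinearAlgebra

/-! ### Existence of the abstract Jordan decomposition. -/

section JordanDecomposition

attribute [local instance 100] LieRing.ofAssociativeRing

variable {K L : Type*} [Field K] [CharZero K] [LieRing L] [LieAlgebra K L]
  [FiniteDimensional K L] [LieAlgebra.IsSemisimple K L]

/-- **Abstract Jordan decomposition**: an element of a semisimple Lie algebra in characteristic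
zero has a semisimple part. -/
theorem exists_isSemisimplePart (x : L) : ∃ s, IsSemisimplePart K x s := by
  have ad_inj : Function.Injective (LieAlgebra.ad K L) := by
    rw [← LieHom.ker_eq_bot, LieAlgebra.ad_ker_eq_self_module_ker]
    exact (LieAlgebra.self_module_ker_eq_center K L).trans (LieAlgebra.center_eq_bot K L)
  set E : L →ₗ[K] Module.End K L := (LieAlgebra.ad K L : L →ₗ[K] Module.End K L)
  obtain ⟨N, hNa, S, hSa, hN, hS, hx⟩ :=
    (LieAlgebra.ad K L x).exists_isNilpotent_isSemisimple
  have hc : Commute N S := Algebra.commute_of_mem_adjoin_singleton_of_commute hSa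
    (Algebra.commute_of_mem_adjoin_self hNa).symm
  -- The adjoint representation `E` embeds `L` in `End L`, where `ad S` is a polynomial `p` in `ad
  -- (N + S)`. Pulled back along `E`, `p (ad x)` is semisimple with nilpotent complement.
  have hE : E ∘ₗ LieAlgebra.ad K L x = LieAlgebra.ad K (Module.End K L) (N + S) ∘ₗ E := by
    ext1 y
    simp [E, ← hx]
  obtain ⟨p, hp⟩ := Algebra.adjoin_singleton_eq_range_aeval K
    (LieAlgebra.ad K (Module.End K L) (N + S)) ▸ LieAlgebra.ad_mem_adjoin_of_isSemisimple hc hN hS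
  have hES : E ∘ₗ Polynomial.aeval (LieAlgebra.ad K L x) p
      = LieAlgebra.ad K (Module.End K L) S ∘ₗ E := by
    rw [aeval_intertwines hE p]
    exact congrArg (· ∘ₗ E) hp
  have hEN : E ∘ₗ (LieAlgebra.ad K L x - Polynomial.aeval (LieAlgebra.ad K L x) p)
      = LieAlgebra.ad K (Module.End K L) N ∘ₗ E := by
    rw [LinearMap.comp_sub, hE, hES, map_add, LinearMap.add_comp, add_sub_cancel_right]
  -- Both `p (ad x)` and `S` are semisimple parts of the operator `ad x`, so uniqueness identifies
  -- them.
  have hS' : Polynomial.aeval (LieAlgebra.ad K L x) p = S := by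
    refine (Module.End.isNilpotent_isSemisimple_unique
      (isNilpotent_of_injective_intertwines ad_inj hEN
        (LieAlgebra.ad_nilpotent_of_nilpotent (R := K) hN))
      (isSemisimple_of_injective_intertwines ad_inj hES
        (LieAlgebra.ad_isSemisimple_of_isSemisimple hS)) hN hS ?_ hc ?_).2
    · have h := (Commute.all Polynomial.X p).map (Polynomial.aeval (LieAlgebra.ad K L x))
      rw [Polynomial.aeval_X] at h
      exact h.sub_left (Commute.refl _)
    · rw [sub_add_cancel, hx]
  rw [hS'] at hES
  have hder : ∀ y, LieAlgebra.ad K L (S y) = S * LieAlgebra.ad K L y - LieAlgebra.ad K L y * S :=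
    fun y => LinearMap.congr_fun hES y
  -- The relation `ad (S y) = [S, ad y]` says that `S` is a derivation of `L`, and every derivation
  -- is inner.
  obtain ⟨s, hs⟩ := LieDerivation.IsKilling.exists_eq_ad (R := K) (L := L)
    { toLinearMap := S
      leibniz' := fun a b => by
        have := LinearMap.congr_fun (hder a) b
        simp only [LieAlgebra.ad_apply, LinearMap.sub_apply, Module.End.mul_apply] at this
        rw [← lie_skew b (S a), this]
        abel }
  have hs' : LieAlgebra.ad K L s = S := by
    ext y
    simpa using congrArg (fun D : LieDerivation K L L => D y) hs
  have hn : LieAlgebra.ad K L (x - s) = N := by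
    rw [map_sub, hs', hx, add_sub_cancel_right]
  refine ⟨s, x - s, by abel, ad_inj ?_, hs' ▸ hS, hn ▸ hN⟩
  rw [LieHom.map_lie, hs', hn, map_zero, Ring.lie_def, hc.eq, sub_self]

end JordanDecomposition

/-! ### The Lie–Poisson bracket on polynomials. -/

section PolynomialBracket

open MvPolynomial

variable {𝕜 𝔤 ι : Type*} [Field 𝕜] [LieRing 𝔤] [LieAlgebra 𝕜 𝔤]

/-- The linear function on `𝔤*` given by an element of `𝔤`. -/
noncomputable def linearFunction (b : Module.Basis ι 𝕜 𝔤) : 𝔤 →ₗ[𝕜] MvPolynomial ι 𝕜 :=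
  b.constr 𝕜 (fun i => (X i : MvPolynomial ι 𝕜))

@[simp]
theorem linearFunction_basis (b : Module.Basis ι 𝕜 𝔤) (i : ι) : linearFunction b (b i) = X i :=
  b.constr_basis 𝕜 _ i

theorem linearFunction_apply [Fintype ι] (b : Module.Basis ι 𝕜 𝔤) (y : 𝔤) :
    linearFunction b y = ∑ i, b.repr y i • (X i : MvPolynomial ι 𝕜) := by
  simp [linearFunction, Module.Basis.constr_apply_fintype]

/-- The coadjoint action of `𝔤` on polynomial functions on `𝔤*`, by derivations. -/
noncomputable def coadjoint (b : Module.Basis ι 𝕜 𝔤) :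
    𝔤 →ₗ[𝕜] Derivation 𝕜 (MvPolynomial ι 𝕜) (MvPolynomial ι 𝕜) where
  toFun y := mkDerivation 𝕜 fun j => linearFunction b ⁅y, b j⁆
  map_add' y z := derivation_ext fun i => by simp
  map_smul' c y := derivation_ext fun i => by simp

theorem coadjoint_X (b : Module.Basis ι 𝕜 𝔤) (y : 𝔤) (j : ι) :
    coadjoint b y (X j) = linearFunction b ⁅y, b j⁆ :=
  mkDerivation_X 𝕜 _ j

variable [Fintype ι]

theorem coadjoint_linearFunction (b : Module.Basis ι 𝕜 𝔤) (y z : 𝔤) :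
    coadjoint b y (linearFunction b z) = linearFunction b ⁅y, z⁆ := by
  rw [linearFunction_apply b z]
  conv_rhs => rw [← b.sum_repr z]
  simp [coadjoint_X, lie_sum, -Module.Basis.sum_repr]

theorem coadjoint_lie (b : Module.Basis ι 𝕜 𝔤) (y z : 𝔤) :
    coadjoint b ⁅y, z⁆ = ⁅coadjoint b y, coadjoint b z⁆ :=
  derivation_ext fun i => by
    rw [Derivation.commutator_apply, coadjoint_X, coadjoint_X, coadjoint_X,
      coadjoint_linearFunction, coadjoint_linearFunction, ← map_sub, lie_lie]

omit [Fintype ι] in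
theorem derivation_sum_apply {α : Type*} (t : Finset α)
    (D : α → Derivation 𝕜 (MvPolynomial ι 𝕜) (MvPolynomial ι 𝕜)) (f : MvPolynomial ι 𝕜) :
    (∑ i ∈ t, D i) f = ∑ i ∈ t, D i f := by
  rw [← Derivation.coeFnAddMonoidHom_apply, map_sum, Finset.sum_apply]
  rfl

/-- The Hamiltonian vector field of a polynomial for the Lie–Poisson bracket. -/
noncomputable def hamiltonian (b : Module.Basis ι 𝕜 𝔤) :
    MvPolynomial ι 𝕜 →ₗ[𝕜] Derivation 𝕜 (MvPolynomial ι 𝕜) (MvPolynomial ι 𝕜) where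
  toFun f := ∑ i, pderiv i f • coadjoint b (b i)
  map_add' f g := by simp [add_smul, Finset.sum_add_distrib]
  map_smul' c f := by simp [Finset.smul_sum]

theorem hamiltonian_apply (b : Module.Basis ι 𝕜 𝔤) (f g : MvPolynomial ι 𝕜) :
    hamiltonian b f g = ∑ i, pderiv i f * coadjoint b (b i) g := by
  simp [hamiltonian, derivation_sum_apply]

theorem coadjoint_apply (b : Module.Basis ι 𝕜 𝔤) (y : 𝔤) (g : MvPolynomial ι 𝕜) :
    coadjoint b y g = ∑ j, pderiv j g * linearFunction b ⁅y, b j⁆ := by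
  classical
  have : coadjoint b y = ∑ j, linearFunction b ⁅y, b j⁆ • pderiv j :=
    derivation_ext fun i => by
      simp [coadjoint_X, derivation_sum_apply, pderiv_X, Pi.single_apply]
  rw [this]
  simp [derivation_sum_apply, mul_comm]

theorem hamiltonian_eq_sum (b : Module.Basis ι 𝕜 𝔤) (f g : MvPolynomial ι 𝕜) :
    hamiltonian b f g
      = ∑ i, ∑ j, linearFunction b ⁅b i, b j⁆ * pderiv i f * pderiv j g := by
  rw [hamiltonian_apply]
  refine Finset.sum_congr rfl fun i _ => ?_
  rw [coadjoint_apply, Finset.mul_sum]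
  exact Finset.sum_congr rfl fun j _ => by ring

theorem hamiltonian_skew (b : Module.Basis ι 𝕜 𝔤) (f g : MvPolynomial ι 𝕜) :
    hamiltonian b f g = -hamiltonian b g f := by
  rw [hamiltonian_eq_sum, hamiltonian_eq_sum, Finset.sum_comm, ← Finset.sum_neg_distrib]
  refine Finset.sum_congr rfl fun i _ => ?_
  rw [← Finset.sum_neg_distrib]
  refine Finset.sum_congr rfl fun j _ => ?_
  rw [← lie_skew, map_neg]
  ring

theorem hamiltonian_linearFunction (b : Module.Basis ι 𝕜 𝔤) (y : 𝔤) :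
    hamiltonian b (linearFunction b y) = coadjoint b y := by
  refine derivation_ext fun i => ?_
  rw [hamiltonian_skew, ← linearFunction_basis b]
  have : ∀ z, hamiltonian b (linearFunction b (b i)) z = coadjoint b (b i) z := by
    intro z
    classical
    rw [hamiltonian_apply, linearFunction_basis]
    simp [pderiv_X, Pi.single_apply]
  rw [this, coadjoint_linearFunction, coadjoint_linearFunction, ← map_neg, lie_skew]

theorem hamiltonian_X (b : Module.Basis ι 𝕜 𝔤) (i : ι) :
    hamiltonian b (X i) = coadjoint b (b i) := by
  rw [← linearFunction_basis b, hamiltonian_linearFunction]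

/-- The Jacobi identity for the Lie–Poisson bracket. -/
theorem hamiltonian_hamiltonian (b : Module.Basis ι 𝕜 𝔤) (f g : MvPolynomial ι 𝕜) :
    hamiltonian b (hamiltonian b f g) = ⁅hamiltonian b f, hamiltonian b g⁆ := by
  -- Derivations are compared on variables. With one argument linear, skew-symmetry moves `f` to the
  -- end and leaves `coadjoint_lie` evaluated at `f`.
  have h1 : ∀ (j : ι) (f : MvPolynomial ι 𝕜), hamiltonian b (hamiltonian b (X j) f)
      = ⁅hamiltonian b (X j), hamiltonian b f⁆ := by
    intro j f
    refine derivation_ext fun k => ?_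
    have h := congrArg (fun D => D f) (coadjoint_lie b (b j) (b k))
    simp only [Derivation.commutator_apply] at h ⊢
    rw [hamiltonian_skew b _ (X k), hamiltonian_skew b f (X k),
      hamiltonian_skew b f (hamiltonian b (X j) (X k))]
    simp only [hamiltonian_X, coadjoint_X, hamiltonian_linearFunction, map_neg]
    rw [h]
    abel
  -- Evaluation at `X j` again makes one of the three arguments linear; skew-symmetry reduces it to
  -- `h1`.
  refine derivation_ext fun j => ?_
  have h := congrArg (fun D => D g) (h1 j f)
  simp only [Derivation.commutator_apply] at h ⊢
  rw [hamiltonian_skew b _ (X j), hamiltonian_skew b g (X j), hamiltonian_skew b f (X j),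
    map_neg, map_neg, hamiltonian_skew b g, h]
  abel

theorem coe_hamiltonian (b : Module.Basis ι 𝕜 𝔤) (f g : MvPolynomial ι 𝕜) :
    (hamiltonian b f g : MvPowerSeries ι 𝕜)
      = poissonBracket b (f : MvPowerSeries ι 𝕜) (g : MvPowerSeries ι 𝕜) := by
  rw [hamiltonian_eq_sum, poissonBracket, ← coeToMvPowerSeries.ringHom_apply, map_sum]
  refine Finset.sum_congr rfl fun i _ => ?_
  rw [map_sum]
  refine Finset.sum_congr rfl fun j _ => ?_
  rw [linearFunction_apply, Finset.sum_mul, Finset.sum_mul, map_sum]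
  refine Finset.sum_congr rfl fun k _ => ?_
  rw [map_mul, map_mul]
  simp [MvPowerSeries.pderiv_coe, structConst]

theorem isHomogeneous_linearFunction (b : Module.Basis ι 𝕜 𝔤) (y : 𝔤) :
    (linearFunction b y).IsHomogeneous 1 := by
  rw [linearFunction_apply]
  exact IsHomogeneous.sum _ _ _ fun i _ => by
    rw [smul_eq_C_mul]
    simpa using (isHomogeneous_C ι (b.repr y i)).mul (isHomogeneous_X 𝕜 i)

/-- Two derivatives and one linear coefficient lower the total degree by one. Indexing by degree
minus one makes the bracket additive, whence the `k + 1` convention below. -/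
theorem isHomogeneous_hamiltonian (b : Module.Basis ι 𝕜 𝔤) {f g : MvPolynomial ι 𝕜} {m n : ℕ}
    (hf : f.IsHomogeneous (m + 1)) (hg : g.IsHomogeneous (n + 1)) :
    (hamiltonian b f g).IsHomogeneous (m + n + 1) := by
  rw [hamiltonian_eq_sum]
  refine IsHomogeneous.sum _ _ _ fun i _ => IsHomogeneous.sum _ _ _ fun j _ => ?_
  have h := ((isHomogeneous_linearFunction b ⁅b i, b j⁆).mul (hf.pderiv (i := i))).mul
    (hg.pderiv (i := j))
  rwa [Nat.add_sub_cancel, Nat.add_sub_cancel, add_comm 1 m, add_right_comm] at h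

end PolynomialBracket

/-! ### The homological equation on homogeneous polynomials. -/

section HomologicalEquation

open MvPolynomial TensorProduct

universe u

variable {𝕜 ι : Type*} {𝔤 : Type u} [Field 𝕜] [CharZero 𝕜] [LieRing 𝔤] [LieAlgebra 𝕜 𝔤]
  [FiniteDimensional 𝕜 𝔤] [Fintype ι]

theorem isSemisimple_rTensor_add_lTensor {V W : Type*} [AddCommGroup V] [Module 𝕜 V]
    [AddCommGroup W] [Module 𝕜 W] [FiniteDimensional 𝕜 V] [FiniteDimensional 𝕜 W]
    {A : Module.End 𝕜 V} {B : Module.End 𝕜 W} (hA : A.IsSemisimple) (hB : B.IsSemisimple) :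
    Module.End.IsSemisimple (M := V ⊗[𝕜] W) (A.rTensor W + B.lTensor V) :=
  Module.End.IsSemisimple.add_of_commute
    (by rw [Commute, SemiconjBy, Module.End.mul_eq_comp, Module.End.mul_eq_comp,
      LinearMap.rTensor_comp_lTensor, LinearMap.lTensor_comp_rTensor])
    (isSemisimple_map_algHom (Module.End.rTensorAlgHom 𝕜 V W) hA)
    (isSemisimple_map_algHom (Module.End.lTensorAlgHom 𝕜 W V) hB)

omit [CharZero 𝕜] in
theorem isNilpotent_rTensor_add_lTensor {V W : Type*} [AddCommGroup V] [Module 𝕜 V]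
    [AddCommGroup W] [Module 𝕜 W]
    {A : Module.End 𝕜 V} {B : Module.End 𝕜 W} (hA : IsNilpotent A) (hB : IsNilpotent B) :
    IsNilpotent (A.rTensor W + B.lTensor V : Module.End 𝕜 (V ⊗[𝕜] W)) :=
  Commute.isNilpotent_add
    (by rw [Commute, SemiconjBy, Module.End.mul_eq_comp, Module.End.mul_eq_comp,
      LinearMap.rTensor_comp_lTensor, LinearMap.lTensor_comp_rTensor])
    (hA.map (Module.End.rTensorAlgHom 𝕜 V W))
    (hB.map (Module.End.lTensorAlgHom 𝕜 W V))

omit [CharZero 𝕜] in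
theorem commute_rTensor_add_lTensor {V W : Type*} [AddCommGroup V] [Module 𝕜 V]
    [AddCommGroup W] [Module 𝕜 W]
    {A A' : Module.End 𝕜 V} {B B' : Module.End 𝕜 W} (hA : Commute A A') (hB : Commute B B') :
    Commute (A.rTensor W + B.lTensor V : Module.End 𝕜 (V ⊗[𝕜] W))
      (A'.rTensor W + B'.lTensor V) := by
  refine TensorProduct.ext' fun v w => ?_
  have h1 := LinearMap.congr_fun hA.eq v
  have h2 := LinearMap.congr_fun hB.eq w
  simp only [Module.End.mul_apply] at h1 h2
  simp [h1, h2]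
  abel

/-- The homogeneous polynomials of degree `k + 1` are a quotient of a finite-dimensional module
on which the actions of `s` and `n` are semisimple, nilpotent and commuting. -/
theorem exists_semisimple_nilpotent_cover (b : Module.Basis ι 𝕜 𝔤) {s n : 𝔤} (hsn : ⁅s, n⁆ = 0)
    (hs : (LieAlgebra.ad 𝕜 𝔤 s).IsSemisimple) (hn : IsNilpotent (LieAlgebra.ad 𝕜 𝔤 n)) (k : ℕ) :
    ∃ (W : Type u) (_ : AddCommGroup W) (_ : Module 𝕜 W) (_ : FiniteDimensional 𝕜 W)
      (π : W →ₗ[𝕜] MvPolynomial ι 𝕜) (S N : Module.End 𝕜 W),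
      LinearMap.range π = homogeneousSubmodule ι 𝕜 (k + 1) ∧ S.IsSemisimple ∧ IsNilpotent N ∧
      Commute N S ∧ (∀ w, π (S w) = coadjoint b s (π w)) ∧
      (∀ w, π (N w) = coadjoint b n (π w)) := by
  have hc : Commute (LieAlgebra.ad 𝕜 𝔤 n) (LieAlgebra.ad 𝕜 𝔤 s) := by
    refine LinearMap.ext fun y => ?_
    have := leibniz_lie s n y
    rw [hsn, zero_lie, zero_add] at this
    simpa using this.symm
  have h1 : LinearMap.range (linearFunction b) = homogeneousSubmodule ι 𝕜 1 := by
    rw [homogeneousSubmodule_one_eq_span_X, linearFunction, b.constr_range]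
  -- The cover is the tensor power of `𝔤` with `k + 1` factors, where Leibniz actions are sums of
  -- commuting operators. The equation is solved there and pushed forward, so semisimplicity need
  -- not be passed to the quotient.
  induction k with
  | zero =>
    exact ⟨𝔤, inferInstance, inferInstance, inferInstance, linearFunction b,
      LieAlgebra.ad 𝕜 𝔤 s, LieAlgebra.ad 𝕜 𝔤 n, h1, hs, hn, hc,
      fun w => (coadjoint_linearFunction b s w).symm,
      fun w => (coadjoint_linearFunction b n w).symm⟩
  | succ k ih =>
    obtain ⟨W, _, _, _, π, S, N, hπ, hS, hN, hNS, hπS, hπN⟩ := ih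
    have key : ∀ (y : 𝔤) (A : Module.End 𝕜 W), (∀ w, π (A w) = coadjoint b y (π w)) →
        ∀ t : 𝔤 ⊗[𝕜] W, TensorProduct.lift ((LinearMap.mul 𝕜 _).compl₁₂ (linearFunction b) π)
          (((LieAlgebra.ad 𝕜 𝔤 y).rTensor W + A.lTensor 𝔤) t)
        = coadjoint b y (TensorProduct.lift
            ((LinearMap.mul 𝕜 _).compl₁₂ (linearFunction b) π) t) := by
      intro y A hA t
      induction t with
      | zero => simp
      | add t t' ht ht' => simp only [map_add, ht, ht']
      | tmul z w =>
        simp [hA, ← coadjoint_linearFunction, mul_comm, add_comm]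
    refine ⟨𝔤 ⊗[𝕜] W, inferInstance, inferInstance, inferInstance,
      TensorProduct.lift ((LinearMap.mul 𝕜 _).compl₁₂ (linearFunction b) π),
      (LieAlgebra.ad 𝕜 𝔤 s).rTensor W + S.lTensor 𝔤,
      (LieAlgebra.ad 𝕜 𝔤 n).rTensor W + N.lTensor 𝔤, ?_,
      isSemisimple_rTensor_add_lTensor hs hS, isNilpotent_rTensor_add_lTensor hn hN,
      commute_rTensor_add_lTensor hc hNS, key s S hπS, key n N hπN⟩
    rw [← homogeneousSubmodule_one_pow 𝕜 (k + 1 + 1), pow_succ',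
      homogeneousSubmodule_one_pow,
      ← hπ, ← h1]
    refine le_antisymm ?_ (Submodule.mul_le.2 ?_)
    · rintro _ ⟨t, rfl⟩
      induction t with
      | zero => simp
      | add t t' ht ht' => rw [map_add]; exact add_mem ht ht'
      | tmul z w => exact Submodule.mul_mem_mul ⟨z, rfl⟩ ⟨w, rfl⟩
    · rintro _ ⟨z, rfl⟩ _ ⟨w, rfl⟩
      exact ⟨z ⊗ₜ w, rfl⟩

/-- The homological equation `v = {x, w}` can be solved in homogeneous polynomials of positive
degree, up to functions commuting with the semisimple part of `x`. -/
theorem exists_coadjoint_sub_eq_zero (b : Module.Basis ι 𝕜 𝔤) {x s : 𝔤}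
    (hs : IsSemisimplePart 𝕜 x s) {k : ℕ} {v : MvPolynomial ι 𝕜} (hv : v.IsHomogeneous (k + 1)) :
    ∃ w : MvPolynomial ι 𝕜, w.IsHomogeneous (k + 1) ∧
      coadjoint b s (v - coadjoint b x w) = 0 := by
  obtain ⟨n, rfl, hsn, hs, hn⟩ := hs
  obtain ⟨W, _, _, _, π, S, N, hπ, hS, hN, hNS, hπS, hπN⟩ :=
    exists_semisimple_nilpotent_cover b hsn hs hn k
  obtain ⟨v, rfl⟩ : v ∈ LinearMap.range π := hπ ▸ hv
  obtain ⟨w, hw⟩ := exists_apply_sub_eq_zero hS hN hNS v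
  refine ⟨π w, ?_, ?_⟩
  · exact (hπ ▸ LinearMap.mem_range_self π w : π w ∈ homogeneousSubmodule ι 𝕜 (k + 1))
  · have := congrArg π hw
    rw [hπS, map_sub, map_zero] at this
    rw [map_add, Derivation.add_apply, ← hπS, ← hπN, ← map_add, ← LinearMap.add_apply]
    exact this

end HomologicalEquation

/-! ### Reindexing of iterated Cauchy products. -/

section Cauchy

open Finset

variable {M : Type*} [AddCommMonoid M]

theorem sum_antidiagonal_assoc (f : ℕ → ℕ → ℕ → M) (n : ℕ) :
    ∑ p ∈ antidiagonal n, ∑ q ∈ antidiagonal p.1, f q.1 q.2 p.2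
      = ∑ p ∈ antidiagonal n, ∑ q ∈ antidiagonal p.2, f p.1 q.1 q.2 := by
  rw [sum_sigma', sum_sigma']
  refine sum_nbij' (fun x => ⟨(x.2.1, x.2.2 + x.1.2), (x.2.2, x.1.2)⟩)
    (fun x => ⟨(x.1.1 + x.2.1, x.2.2), (x.1.1, x.2.1)⟩) ?_ ?_ ?_ ?_ ?_ <;>
  simp only [mem_sigma, HasAntidiagonal.mem_antidiagonal, Sigma.forall, Prod.forall] <;>
  rintro a b c d ⟨rfl, h⟩ <;> subst h <;> simp [add_assoc]

theorem sum_antidiagonal_left_comm (f : ℕ → ℕ → ℕ → M) (n : ℕ) :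
    ∑ p ∈ antidiagonal n, ∑ q ∈ antidiagonal p.2, f p.1 q.1 q.2
      = ∑ p ∈ antidiagonal n, ∑ q ∈ antidiagonal p.2, f q.1 p.1 q.2 := by
  rw [← sum_antidiagonal_assoc, ← sum_antidiagonal_assoc (fun a b c => f b a c)]
  exact sum_congr rfl fun p _ => (Nat.sum_antidiagonal_swap (f := fun q => f q.1 q.2 p.2)).symm

theorem sum_antidiagonal_four_comm (f : ℕ → ℕ → ℕ → ℕ → M) (n : ℕ) :
    ∑ p ∈ antidiagonal n, ∑ q ∈ antidiagonal p.1, ∑ r ∈ antidiagonal p.2, f q.1 q.2 r.1 r.2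
      = ∑ p ∈ antidiagonal n, ∑ q ∈ antidiagonal p.1, ∑ r ∈ antidiagonal p.2,
          f q.1 r.1 q.2 r.2 := by
  rw [sum_antidiagonal_assoc (fun a b c => ∑ r ∈ antidiagonal c, f a b r.1 r.2),
    sum_antidiagonal_assoc (fun a b c => ∑ r ∈ antidiagonal c, f a r.1 b r.2)]
  exact sum_congr rfl fun p _ => sum_antidiagonal_left_comm (f p.1) p.2

end Cauchy

/-! ### Formal flows of a bilinear bracket satisfying the Leibniz identity. -/

section Flow

open Finset

variable {K L : Type*} [Field K] [AddCommGroup L] [Module K L]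

/-- The coefficients `θ k` of the formal flow `θ(t) = ∑ k, t ^ k θ k` solving
`t θ'(t) = - (∑ k, t ^ (k + 1) B (G k)) θ(t)`, `θ(0) = 1`. -/
noncomputable def flow (B : L →ₗ[K] Module.End K L) (G : ℕ → L) : ℕ → Module.End K L
  | 0 => 1
  | k + 1 => -((k + 1 : K)⁻¹ • ∑ j : Fin (k + 1), B (G (k - j)) * flow B G j)

variable (B : L →ₗ[K] Module.End K L) (G : ℕ → L)

@[simp]
theorem flow_zero : flow B G 0 = 1 := by rw [flow]

theorem flow_succ (k : ℕ) :
    flow B G (k + 1)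
      = -((k + 1 : K)⁻¹ • ∑ p ∈ antidiagonal k, B (G p.1) * flow B G p.2) := by
  rw [flow, Finset.sum_fin_eq_sum_range,
    ← Nat.sum_antidiagonal_swap]
  simp only [Prod.fst_swap, Prod.snd_swap]
  rw [Nat.sum_antidiagonal_eq_sum_range_succ (fun i j => B (G j) * flow B G i)]
  congr 2
  exact sum_congr rfl fun i hi => by simp [mem_range.1 hi]

theorem smul_flow_succ [CharZero K] (k : ℕ) :
    ((k + 1 : ℕ) : K) • flow B G (k + 1)
      = -∑ p ∈ antidiagonal k, B (G p.1) * flow B G p.2 := by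
  rw [flow_succ, smul_neg, smul_smul, Nat.cast_add, Nat.cast_one,
    mul_inv_cancel₀ (by exact_mod_cast Nat.succ_ne_zero k), one_smul]

theorem flow_congr {G G' : ℕ → L} {k : ℕ} (h : ∀ j < k, G j = G' j) :
    flow B G k = flow B G' k := by
  induction k using Nat.strong_induction_on with
  | _ k ih =>
    cases k with
    | zero => simp
    | succ k =>
      rw [flow_succ, flow_succ]
      congr 2
      refine sum_congr rfl fun p hp => ?_
      have := HasAntidiagonal.mem_antidiagonal.1 hp
      rw [h p.1 (by omega), ih p.2 (by omega) fun j hj => h j (by omega)]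

/-- In weight `k + 1` the entry `G k` occurs only in the term `(k, 0)`, paired with `flow 0 = 1`;
the dependence on it is therefore affine. -/
theorem flow_update_succ (k : ℕ) (g : L) :
    flow B (Function.update G k g) (k + 1)
      = flow B (Function.update G k 0) (k + 1) - (k + 1 : K)⁻¹ • B g := by
  have hmem : (k, 0) ∈ antidiagonal k := by simp
  have hsum : ∑ p ∈ (antidiagonal k).erase (k, 0),
        B (Function.update G k g p.1) * flow B (Function.update G k g) p.2
      = ∑ p ∈ (antidiagonal k).erase (k, 0),
        B (Function.update G k 0 p.1) * flow B (Function.update G k 0) p.2 := by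
    refine sum_congr rfl fun p hp => ?_
    rw [mem_erase, HasAntidiagonal.mem_antidiagonal, Ne, Prod.ext_iff] at hp
    have hp1 : p.1 ≠ k := fun h => hp.1 ⟨h, by simp only; omega⟩
    rw [Function.update_of_ne hp1, Function.update_of_ne hp1,
      flow_congr B (G' := Function.update G k 0) fun j hj => by
        rw [Function.update_of_ne (by omega), Function.update_of_ne (by omega)]]
  rw [flow_succ, flow_succ, ← add_sum_erase _ _ hmem, ← add_sum_erase _ _ hmem, hsum]
  simp [smul_add]
  abel

/-- The weight `k` generator shifted so that the flow equation takes a uniform form. -/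
def shifted (G : ℕ → L) : ℕ → L
  | 0 => 0
  | k + 1 => G k

theorem natCast_smul_flow [CharZero K] (k : ℕ) :
    (k : K) • flow B G k = -∑ p ∈ antidiagonal k, B (shifted G p.1) * flow B G p.2 := by
  cases k with
  | zero => simp [shifted]
  | succ k => rw [smul_flow_succ, Nat.sum_antidiagonal_succ]; simp [shifted]

/-- The flow of a family of derivations of a bilinear bracket preserves the bracket. -/
theorem flow_bracket [CharZero K]
    (hB : ∀ g a b, B g (B a b) = B (B g a) b + B a (B g b)) (a b : L) (k : ℕ) :
    flow B G k (B a b) = ∑ p ∈ antidiagonal k, B (flow B G p.1 a) (flow B G p.2 b) := by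
  induction k using Nat.strong_induction_on with
  | _ k ih =>
    rcases Nat.eq_zero_or_pos k with rfl | hk
    · simp
    have hk' : (k : K) ≠ 0 := by exact_mod_cast hk.ne'
    -- After multiplication by `k ≠ 0` the flow equation applies to both sides: on the right, `k =
    -- p.1 + p.2` splits by the product rule; on the left, `hB` and induction give the same triple
    -- sums.
    refine smul_right_injective L hk' ?_
    have ode : ∀ (i : ℕ) (c : L), (i : K) • flow B G i c
        = -∑ p ∈ antidiagonal i, B (shifted G p.1) (flow B G p.2 c) := by
      intro i c
      simpa using LinearMap.congr_fun (natCast_smul_flow B G i) c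
    have e1 : (k : K) • flow B G k (B a b) = -∑ p ∈ antidiagonal k,
        ∑ q ∈ antidiagonal p.2, (B (B (shifted G p.1) (flow B G q.1 a)) (flow B G q.2 b)
          + B (flow B G q.1 a) (B (shifted G p.1) (flow B G q.2 b))) := by
      rw [ode]
      congr 1
      refine sum_congr rfl fun p hp => ?_
      rcases p with ⟨i, j⟩
      have hij := HasAntidiagonal.mem_antidiagonal.1 hp
      cases i with
      | zero => simp [shifted]
      | succ i =>
        rw [ih j (by simp at hij; omega), map_sum]
        exact sum_congr rfl fun q _ => hB _ _ _
    have e2 : (k : K) • ∑ p ∈ antidiagonal k, B (flow B G p.1 a) (flow B G p.2 b)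
        = ∑ p ∈ antidiagonal k, (B ((p.1 : K) • flow B G p.1 a) (flow B G p.2 b)
          + B (flow B G p.1 a) ((p.2 : K) • flow B G p.2 b)) := by
      rw [smul_sum]
      refine sum_congr rfl fun p hp => ?_
      rw [map_smul, map_smul, LinearMap.smul_apply, ← add_smul, ← Nat.cast_add,
        HasAntidiagonal.mem_antidiagonal.1 hp]
    simp only
    rw [e1, e2]
    simp only [ode, map_neg, map_sum, LinearMap.neg_apply, LinearMap.sum_apply, sum_add_distrib,
      sum_neg_distrib, neg_add]
    rw [sum_antidiagonal_assoc
        (fun l m j => B (B (shifted G l) (flow B G m a)) (flow B G j b)),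
      sum_antidiagonal_left_comm
        (fun i l m => B (flow B G i a) (B (shifted G l) (flow B G m b)))]

/-- The action of a formal family of endomorphisms on a formal family of vectors. -/
def seqAct (θ : ℕ → Module.End K L) (v : ℕ → L) (k : ℕ) : L :=
  ∑ p ∈ antidiagonal k, θ p.1 (v p.2)

/-- The bracket of formal families of vectors. -/
def seqBracket (v w : ℕ → L) (k : ℕ) : L :=
  ∑ p ∈ antidiagonal k, B (v p.1) (w p.2)

theorem seqAct_congr {θ θ' : ℕ → Module.End K L} {v : ℕ → L} {k : ℕ}
    (h : ∀ j ≤ k, θ j = θ' j) : seqAct θ v k = seqAct θ' v k :=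
  sum_congr rfl fun p hp => by
    rw [h p.1 (by have := HasAntidiagonal.mem_antidiagonal.1 hp; omega)]

theorem seqAct_flow_update_succ (k : ℕ) (g : L) (v : ℕ → L) :
    seqAct (flow B (Function.update G k g)) v (k + 1)
      = seqAct (flow B (Function.update G k 0)) v (k + 1) - (k + 1 : K)⁻¹ • B g (v 0) := by
  rw [seqAct, seqAct, Nat.sum_antidiagonal_succ', Nat.sum_antidiagonal_succ', flow_update_succ]
  have : ∀ p ∈ antidiagonal k, flow B (Function.update G k g) p.1 (v (p.2 + 1))
      = flow B (Function.update G k 0) p.1 (v (p.2 + 1)) := by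
    intro p hp
    have := HasAntidiagonal.mem_antidiagonal.1 hp
    rw [flow_congr B (G' := Function.update G k 0) fun j hj => by
        rw [Function.update_of_ne (by omega), Function.update_of_ne (by omega)]]
  rw [sum_congr rfl this]
  simp
  abel

theorem seqAct_flow_seqBracket [CharZero K]
    (hB : ∀ g a b, B g (B a b) = B (B g a) b + B a (B g b)) (v w : ℕ → L) :
    seqAct (flow B G) (seqBracket B v w)
      = seqBracket B (seqAct (flow B G) v) (seqAct (flow B G) w) := by
  funext k
  simp only [seqAct, seqBracket, map_sum, LinearMap.sum_apply, flow_bracket B G hB]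
  have h := sum_antidiagonal_four_comm
    (fun l m i j => B (flow B G l (v i)) (flow B G m (w j))) k
  refine Eq.trans ?_ (h.trans ?_)
  · exact sum_congr rfl fun p _ => sum_comm
  · exact sum_congr rfl fun p _ => sum_comm

/-- The action is triangular with identity on the diagonal. -/
theorem seqAct_injective {θ : ℕ → Module.End K L} (h0 : θ 0 = 1) :
    Function.Injective (seqAct θ) := by
  intro v w h
  funext k
  induction k using Nat.strong_induction_on with
  | _ k ih =>
    have hk := congrFun h k
    cases k with
    | zero => simpa [seqAct, h0] using hk
    | succ k =>
      simp only [seqAct, Nat.sum_antidiagonal_succ, h0, Module.End.one_apply] at hk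
      have : ∑ p ∈ antidiagonal k, θ (p.1 + 1) (v p.2)
          = ∑ p ∈ antidiagonal k, θ (p.1 + 1) (w p.2) :=
        sum_congr rfl fun p hp => by
          rw [ih p.2 (by have := HasAntidiagonal.mem_antidiagonal.1 hp; omega)]
      rw [this] at hk
      exact add_right_cancel hk

/-- The constant family. -/
def constSeq (a : L) : ℕ → L
  | 0 => a
  | _ + 1 => 0

/-- The inverse of a formal family of endomorphisms starting with the identity. -/
noncomputable def inverseFlow (θ : ℕ → Module.End K L) (k : ℕ) : Module.End K L :=
  PowerSeries.coeff k ((PowerSeries.mk θ).invOfUnit 1)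

theorem seqAct_inverseFlow {θ : ℕ → Module.End K L} (h0 : θ 0 = 1) (a : L) :
    seqAct θ (fun k => inverseFlow θ k a) = constSeq a := by
  funext k
  have h := congrArg (fun ψ : PowerSeries (Module.End K L) => PowerSeries.coeff k ψ a)
    (PowerSeries.mul_invOfUnit (PowerSeries.mk θ) 1 (by simp [h0]))
  simp only [PowerSeries.coeff_mul, PowerSeries.coeff_mk, LinearMap.sum_apply,
    Module.End.mul_apply] at h
  rw [seqAct]
  refine h.trans ?_
  cases k <;> simp [constSeq, PowerSeries.coeff_one]

theorem seqBracket_constSeq_right (v : ℕ → L) (a : L) (k : ℕ) :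
    seqBracket B v (constSeq a) k = B (v k) a := by
  cases k with
  | zero => simp [seqBracket, constSeq]
  | succ k => simp [seqBracket, Nat.sum_antidiagonal_succ', constSeq]

/-- The inverse of a bracket-preserving flow preserves brackets: apply the flow, which is injective,
to both sides. -/
theorem seqBracket_inverseFlow [CharZero K]
    (hB : ∀ g a b, B g (B a b) = B (B g a) b + B a (B g b)) (a b : L) :
    seqBracket B (fun k => inverseFlow (flow B G) k a) (fun k => inverseFlow (flow B G) k b)
      = fun k => inverseFlow (flow B G) k (B a b) := by
  have h0 := flow_zero B G
  apply seqAct_injective h0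
  rw [seqAct_flow_seqBracket B G hB, seqAct_inverseFlow h0, seqAct_inverseFlow h0,
    seqAct_inverseFlow h0]
  funext k
  rw [seqBracket_constSeq_right]
  cases k <;> simp [constSeq]

theorem seqBracket_inverseFlow_eq_zero [CharZero K]
    (hB : ∀ g a b, B g (B a b) = B (B g a) b + B a (B g b)) {h : ℕ → L} {s : L}
    (hs : ∀ k, B (seqAct (flow B G) h k) s = 0) :
    seqBracket B h (fun k => inverseFlow (flow B G) k s) = 0 := by
  have h0 := flow_zero B G
  apply seqAct_injective h0
  rw [seqAct_flow_seqBracket B G hB, seqAct_inverseFlow h0]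
  funext k
  rw [seqBracket_constSeq_right, hs]
  simp [seqAct]

/-- Sequences can be constructed recursively subject to conditions on initial segments. -/
theorem exists_seq_of_forall_exists_update {α : Type*} [Nonempty α] (P : ℕ → (ℕ → α) → Prop)
    (hP : ∀ k G G', (∀ j ≤ k, G j = G' j) → P k G → P k G')
    (H : ∀ k G, (∀ j < k, P j G) → ∃ g, P k (Function.update G k g)) :
    ∃ G, ∀ k, P k G := by
  classical
  choose! g hg using H
  -- `F n` has its entries below `n` fixed for good; the answer is the diagonal `F (k + 1) k`.
  let F : ℕ → ℕ → α := fun n => Nat.rec (fun _ => Classical.arbitrary α)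
    (fun k G => Function.update G k (g k G)) n
  have hF : ∀ k, F (k + 1) = Function.update (F k) k (g k (F k)) := fun k => rfl
  have hstab : ∀ n k j, k ≤ n → j < k → F n j = F k j := by
    intro n k j hkn hj
    induction n, hkn using Nat.le_induction with
    | base => rfl
    | succ n hn ih => rw [hF, Function.update_of_ne (by omega), ih]
  have hall : ∀ k, P k (F (k + 1)) := by
    intro k
    induction k using Nat.strong_induction_on with
    | _ k ih =>
      rw [hF]
      exact hg k _ fun j hj => hP j _ _
        (fun i hi => (hstab k (j + 1) i (by omega) (by omega)).symm) (ih j hj)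
  exact ⟨fun k => F (k + 1) k, fun k => hP k _ _
    (fun j hj => hstab (k + 1) (j + 1) j (by omega) (by omega)) (hall k)⟩

end Flow

/-! ### Degrees along the flow and the choice of generators. -/

section Homogeneous

open MvPolynomial

variable {𝕜 𝔤 ι : Type*} [Field 𝕜] [LieRing 𝔤] [LieAlgebra 𝕜 𝔤] [Fintype ι]

/-- The Lie–Poisson bracket of polynomials as a bilinear map. -/
noncomputable def polynomialBracket (b : Module.Basis ι 𝕜 𝔤) :
    MvPolynomial ι 𝕜 →ₗ[𝕜] Module.End 𝕜 (MvPolynomial ι 𝕜) where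
  toFun f := (hamiltonian b f : MvPolynomial ι 𝕜 →ₗ[𝕜] MvPolynomial ι 𝕜)
  map_add' f g := by rw [map_add]; rfl
  map_smul' c f := by rw [map_smul]; rfl

theorem polynomialBracket_apply (b : Module.Basis ι 𝕜 𝔤) (f g : MvPolynomial ι 𝕜) :
    polynomialBracket b f g = hamiltonian b f g :=
  rfl

theorem polynomialBracket_leibniz (b : Module.Basis ι 𝕜 𝔤) (f g h : MvPolynomial ι 𝕜) :
    polynomialBracket b f (polynomialBracket b g h)
      = polynomialBracket b (polynomialBracket b f g) h
        + polynomialBracket b g (polynomialBracket b f h) := by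
  simp only [polynomialBracket_apply, hamiltonian_hamiltonian, Derivation.commutator_apply]
  abel

variable (b : Module.Basis ι 𝕜 𝔤) {G : ℕ → MvPolynomial ι 𝕜}

theorem isHomogeneous_flow {k m : ℕ} (hG : ∀ j < k, (G j).IsHomogeneous (j + 2))
    {f : MvPolynomial ι 𝕜} (hf : f.IsHomogeneous (m + 1)) :
    (flow (polynomialBracket b) G k f).IsHomogeneous (k + m + 1) := by
  induction k using Nat.strong_induction_on with
  | _ k ih =>
    cases k with
    | zero => simpa using hf
    | succ k =>
      rw [flow_succ]
      refine (homogeneousSubmodule ι 𝕜 _).neg_mem (Submodule.smul_mem _ _ ?_)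
      rw [LinearMap.sum_apply]
      refine Submodule.sum_mem _ fun p hp => ?_
      have hp := Finset.HasAntidiagonal.mem_antidiagonal.1 hp
      have := isHomogeneous_hamiltonian b (m := p.1 + 1) (hG p.1 (by omega))
        (ih p.2 (by omega) fun j hj => hG j (by omega))
      rw [show p.1 + 1 + (p.2 + m) + 1 = k + 1 + m + 1 by omega] at this
      exact this

theorem isHomogeneous_seqAct_flow {k : ℕ} (hG : ∀ j < k, (G j).IsHomogeneous (j + 2))
    {v : ℕ → MvPolynomial ι 𝕜} (hv : ∀ k, (v k).IsHomogeneous (k + 1)) :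
    (seqAct (flow (polynomialBracket b) G) v k).IsHomogeneous (k + 1) :=
  IsHomogeneous.sum _ _ _ fun p hp => by
    have hp := Finset.HasAntidiagonal.mem_antidiagonal.1 hp
    have := isHomogeneous_flow b (fun j (hj : j < p.1) => hG j (by omega)) (hv p.2)
    rwa [hp] at this

theorem isHomogeneous_inverseFlow (hG : ∀ j, (G j).IsHomogeneous (j + 2))
    {f : MvPolynomial ι 𝕜} (hf : f.IsHomogeneous 1) (k : ℕ) :
    (inverseFlow (flow (polynomialBracket b) G) k f).IsHomogeneous (k + 1) := by
  have h0 := flow_zero (polynomialBracket b) G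
  induction k using Nat.strong_induction_on with
  | _ k ih =>
    -- The relation `θ ψ f = f`, read in weight `k`, expresses `ψ k f` through lower weights.
    have h := congrFun (seqAct_inverseFlow h0 f) k
    cases k with
    | zero =>
      rw [seqAct, Finset.Nat.antidiagonal_zero, Finset.sum_singleton, h0] at h
      rw [show inverseFlow (flow (polynomialBracket b) G) 0 f = f from h]
      exact hf
    | succ k =>
      rw [seqAct, Finset.Nat.sum_antidiagonal_succ, h0, Module.End.one_apply] at h
      rw [eq_neg_of_add_eq_zero_left h]
      refine (homogeneousSubmodule ι 𝕜 _).neg_mem (Submodule.sum_mem _ fun p hp => ?_)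
      have hp := Finset.HasAntidiagonal.mem_antidiagonal.1 hp
      have := isHomogeneous_flow b (k := p.1 + 1) (fun j _ => hG j) (ih p.2 (by omega))
      rw [show p.1 + 1 + p.2 + 1 = k + 1 + 1 by omega] at this
      exact this

/-- A formal function with linear part `x` is brought into normal form with respect to the
semisimple part of `x` by the flow of some generator of order at least two. -/
theorem exists_normalizing_generator [CharZero 𝕜] [FiniteDimensional 𝕜 𝔤] {x s : 𝔤}
    (hs : IsSemisimplePart 𝕜 x s) {h : ℕ → MvPolynomial ι 𝕜}
    (hh : ∀ k, (h k).IsHomogeneous (k + 1)) (h0 : h 0 = linearFunction b x) :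
    ∃ G : ℕ → MvPolynomial ι 𝕜, (∀ k, (G k).IsHomogeneous (k + 2)) ∧
      ∀ k, coadjoint b s (seqAct (flow (polynomialBracket b) G) h k) = 0 := by
  -- The condition at stage `k` concerns weight `k + 1`, the first one that `G k` influences.
  have key := exists_seq_of_forall_exists_update
    (fun k (G : ℕ → MvPolynomial ι 𝕜) => (G k).IsHomogeneous (k + 2) ∧
      coadjoint b s (seqAct (flow (polynomialBracket b) G) h (k + 1)) = 0) ?_ ?_
  · obtain ⟨G, hG⟩ := key
    refine ⟨G, fun k => (hG k).1, fun k => ?_⟩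
    cases k with
    | zero =>
      -- Weight zero is untouched by the flow and is already normal, since `[s, s + n] = 0`.
      obtain ⟨n, rfl, hsn, -⟩ := hs
      simp [seqAct, h0, coadjoint_linearFunction, hsn]
    | succ k => exact (hG k).2
  · rintro k G G' hGG' ⟨h1, h2⟩
    refine ⟨hGG' k le_rfl ▸ h1, ?_⟩
    rwa [← seqAct_congr fun j hj => flow_congr _ fun i hi => hGG' i (by omega)]
  · intro k G hG
    have hR : (seqAct (flow (polynomialBracket b) (Function.update G k 0)) h
        (k + 1)).IsHomogeneous (k + 1 + 1) := by
      refine isHomogeneous_seqAct_flow b (fun j hj => ?_) hh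
      rcases eq_or_ne j k with rfl | hjk
      · rw [Function.update_self]
        exact isHomogeneous_zero _ _ _
      · rw [Function.update_of_ne hjk]
        exact (hG j (by omega)).1
    obtain ⟨w, hw, hw'⟩ := exists_coadjoint_sub_eq_zero b hs hR
    -- The scalar cancels the factor `-(k + 1)⁻¹` from the flow; skew-symmetry then turns `{w, x}`
    -- into `-{x, w}`.
    refine ⟨-((k + 1 : 𝕜) • w), ?_, ?_⟩
    · rw [Function.update_self]
      exact (homogeneousSubmodule ι 𝕜 _).neg_mem (Submodule.smul_mem _ _ hw)
    · have hk : (k + 1 : 𝕜) ≠ 0 := by exact_mod_cast Nat.succ_ne_zero k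
      rw [seqAct_flow_update_succ, h0, polynomialBracket_apply, hamiltonian_skew,
        hamiltonian_linearFunction, map_neg, neg_neg, Derivation.map_smul, smul_smul, inv_mul_cancel₀ hk,
        one_smul, hw']

end Homogeneous

/-! ### From homogeneous components to power series, and the normalization. -/

section Assembly

open MvPolynomial

variable {𝕜 𝔤 ι : Type*} [Field 𝕜] [LieRing 𝔤] [LieAlgebra 𝕜 𝔤]

/-- The formal power series whose homogeneous component of degree `k + 1` is that of `v k`. -/
noncomputable def ofComponents : (ℕ → MvPolynomial ι 𝕜) →ₗ[𝕜] MvPowerSeries ι 𝕜 where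
  toFun v := fun α => coeff α (v (α.degree - 1))
  map_add' v w := by ext α; exact coeff_add _ _ _
  map_smul' c v := by ext α; exact coeff_smul _ _ _

theorem coeff_ofComponents (v : ℕ → MvPolynomial ι 𝕜) (α : ι →₀ ℕ) :
    MvPowerSeries.coeff α (ofComponents v) = coeff α (v (α.degree - 1)) :=
  rfl

/-- In degree zero the truncated `α.degree - 1` selects `v 0`, which is harmless because `v 0` has
no constant term. -/
theorem coeff_sum_range_of_isHomogeneous {v : ℕ → MvPolynomial ι 𝕜}
    (hv : ∀ k, (v k).IsHomogeneous (k + 1)) {n : ℕ} {α : ι →₀ ℕ} (hα : α.degree ≤ n) :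
    coeff α (∑ k ∈ Finset.range n, v k) = coeff α (v (α.degree - 1)) := by
  rw [coeff_sum]
  rcases Nat.eq_zero_or_pos α.degree with h | h
  · rw [(hv _).coeff_eq_zero (by omega)]
    exact Finset.sum_eq_zero fun k _ => (hv k).coeff_eq_zero (by omega)
  · refine Finset.sum_eq_single _ (fun k _ hk => (hv k).coeff_eq_zero (by omega)) fun hk => ?_
    exact absurd (Finset.mem_range.2 (by omega)) hk

theorem coeff_mul_congr {f f' g g' : MvPowerSeries ι 𝕜} {n : ℕ}
    (hf : ∀ α : ι →₀ ℕ, α.degree ≤ n → MvPowerSeries.coeff α f = MvPowerSeries.coeff α f')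
    (hg : ∀ α : ι →₀ ℕ, α.degree ≤ n → MvPowerSeries.coeff α g = MvPowerSeries.coeff α g')
    (α : ι →₀ ℕ) (hα : α.degree ≤ n) :
    MvPowerSeries.coeff α (f * g) = MvPowerSeries.coeff α (f' * g') := by
  classical
  rw [MvPowerSeries.coeff_mul, MvPowerSeries.coeff_mul]
  refine Finset.sum_congr rfl fun p hp => ?_
  have hp : p.1.degree + p.2.degree = α.degree := by
    rw [← map_add, Finset.HasAntidiagonal.mem_antidiagonal.1 hp]
  rw [hf p.1 (by omega), hg p.2 (by omega)]

variable [Fintype ι] (b : Module.Basis ι 𝕜 𝔤)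

/-- Each argument is differentiated once, so its coefficients up to degree `n + 1` suffice. This
allows power series to be replaced by polynomial truncations. -/
theorem coeff_poissonBracket_congr {f f' g g' : MvPowerSeries ι 𝕜} {n : ℕ}
    (hf : ∀ α : ι →₀ ℕ, α.degree ≤ n + 1 → MvPowerSeries.coeff α f = MvPowerSeries.coeff α f')
    (hg : ∀ α : ι →₀ ℕ, α.degree ≤ n + 1 → MvPowerSeries.coeff α g = MvPowerSeries.coeff α g')
    (α : ι →₀ ℕ) (hα : α.degree ≤ n) :
    MvPowerSeries.coeff α (poissonBracket b f g)
      = MvPowerSeries.coeff α (poissonBracket b f' g') := by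
  have hd : ∀ {f f' : MvPowerSeries ι 𝕜} (i : ι),
      (∀ α : ι →₀ ℕ, α.degree ≤ n + 1 → MvPowerSeries.coeff α f = MvPowerSeries.coeff α f') →
      ∀ α : ι →₀ ℕ, α.degree ≤ n → MvPowerSeries.coeff α (MvPowerSeries.pderiv 𝕜 i f)
        = MvPowerSeries.coeff α (MvPowerSeries.pderiv 𝕜 i f') := by
    intro f f' i h α hα
    rw [MvPowerSeries.coeff_pderiv, MvPowerSeries.coeff_pderiv, h _ (by simpa using hα)]
  simp only [poissonBracket, map_sum, map_smul]
  refine Finset.sum_congr rfl fun i _ => Finset.sum_congr rfl fun j _ =>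
    Finset.sum_congr rfl fun k _ => ?_
  rw [coeff_mul_congr (coeff_mul_congr (fun _ _ => rfl) (hd i hf)) (hd j hg) α hα]

theorem poissonBracket_ofComponents {v w : ℕ → MvPolynomial ι 𝕜}
    (hv : ∀ k, (v k).IsHomogeneous (k + 1)) (hw : ∀ k, (w k).IsHomogeneous (k + 1)) :
    poissonBracket b (ofComponents v) (ofComponents w)
      = ofComponents (seqBracket (polynomialBracket b) v w) := by
  ext α
  have approx : ∀ {v : ℕ → MvPolynomial ι 𝕜}, (∀ k, (v k).IsHomogeneous (k + 1)) →
      ∀ β : ι →₀ ℕ, β.degree ≤ α.degree + 1 → MvPowerSeries.coeff β (ofComponents v)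
        = MvPowerSeries.coeff β
          ((∑ k ∈ Finset.range (α.degree + 1), v k : MvPolynomial ι 𝕜) : MvPowerSeries ι 𝕜) :=
    fun hv β hβ => by
      rw [MvPolynomial.coeff_coe, coeff_sum_range_of_isHomogeneous hv hβ, coeff_ofComponents]
  have hhom : ∀ i j, (hamiltonian b (v i) (w j)).IsHomogeneous (i + j + 1) :=
    fun i j => isHomogeneous_hamiltonian b (hv i) (hw j)
  rw [coeff_poissonBracket_congr b (approx hv) (approx hw) α le_rfl, ← coe_hamiltonian,
    MvPolynomial.coeff_coe, coeff_ofComponents, seqBracket, ← polynomialBracket_apply]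
  simp only [map_sum, LinearMap.sum_apply, coeff_sum, polynomialBracket_apply]
  rw [Finset.sum_comm, ← Finset.sum_product']
  rcases Nat.eq_zero_or_pos α.degree with h | h
  · rw [Finset.sum_eq_zero fun p _ => (hhom p.1 p.2).coeff_eq_zero (by omega),
      Finset.sum_eq_zero fun p _ => (hhom p.1 p.2).coeff_eq_zero (by omega)]
  -- The term indexed by `(i, j)` has degree `i + j + 1`, so only the antidiagonal of `α.degree - 1`
  -- contributes.
  · refine (Finset.sum_subset (fun p hp => ?_) fun p _ hp => ?_).symm
    · have := Finset.HasAntidiagonal.mem_antidiagonal.1 hp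
      simp only [Finset.mem_product, Finset.mem_range]
      omega
    · rw [Finset.HasAntidiagonal.mem_antidiagonal] at hp
      exact (hhom p.1 p.2).coeff_eq_zero (by omega)

/-- The homogeneous component of degree `k + 1` of a formal power series. -/
noncomputable def components (h : MvPowerSeries ι 𝕜) (k : ℕ) : MvPolynomial ι 𝕜 :=
  homogeneousComponent (k + 1) (MvPowerSeries.truncTotal (k + 2) h)

theorem coeff_components (h : MvPowerSeries ι 𝕜) (k : ℕ) (α : ι →₀ ℕ) :
    coeff α (components h k) = if α.degree = k + 1 then MvPowerSeries.coeff α h else 0 := by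
  rw [components, coeff_homogeneousComponent]
  split_ifs with hα
  · rw [MvPowerSeries.coeff_truncTotal _ (by omega)]
  · rfl

theorem isHomogeneous_components (h : MvPowerSeries ι 𝕜) (k : ℕ) :
    (components h k).IsHomogeneous (k + 1) :=
  homogeneousComponent_isHomogeneous _ _

theorem ofComponents_components {h : MvPowerSeries ι 𝕜}
    (h0 : MvPowerSeries.constantCoeff h = 0) : ofComponents (components h) = h := by
  ext α
  rw [coeff_ofComponents, coeff_components]
  split_ifs with hα
  · rfl
  · have : α = 0 := by
      rw [← Finsupp.degree_eq_zero_iff]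
      omega
    rw [this, MvPowerSeries.coeff_zero_eq_constantCoeff_apply, h0]

theorem coeff_single_linearFunction (y : 𝔤) (i : ι) :
    coeff (Finsupp.single i 1) (linearFunction b y) = b.repr y i := by
  classical
  rw [linearFunction_apply]
  simp [coeff_sum, coeff_X, Finsupp.single_left_inj]

theorem components_zero (h : MvPowerSeries ι 𝕜) :
    components h 0 = linearFunction b (differentialAtZero b h) := by
  ext α
  rw [coeff_components]
  split_ifs with hα
  · obtain ⟨i, rfl⟩ : α ∈ Set.range fun i : ι => Finsupp.single i 1 :=
      Finsupp.range_single_one ▸ hα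
    rw [coeff_single_linearFunction, differentialAtZero]
    exact (congrFun (b.repr_sum_self fun i => MvPowerSeries.coeff (Finsupp.single i 1) h) i).symm
  · exact ((isHomogeneous_linearFunction b _).coeff_eq_zero hα).symm

theorem differentialAtZero_ofComponents {v : ℕ → MvPolynomial ι 𝕜} {s : 𝔤}
    (hv : v 0 = linearFunction b s) : differentialAtZero b (ofComponents v) = s := by
  rw [differentialAtZero]
  simp only [coeff_ofComponents, Finsupp.degree_single, Nat.sub_self, hv,
    coeff_single_linearFunction, b.sum_repr]

/-- Formal Poincaré–Birkhoff normalization on the dual of a finite-dimensional Lie algebra, given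
a semisimple part of the differential. -/
theorem admitsFormalNormalization_of_isSemisimplePart [CharZero 𝕜] [DecidableEq ι]
    {h : MvPowerSeries ι 𝕜} (h0 : MvPowerSeries.constantCoeff h = 0) {s : 𝔤}
    (hs : IsSemisimplePart 𝕜 (differentialAtZero b h) s) : AdmitsFormalNormalization b h := by
  have : FiniteDimensional 𝕜 𝔤 := Module.Finite.of_basis b
  obtain ⟨G, hG, hnorm⟩ := exists_normalizing_generator b hs (isHomogeneous_components h)
    (components_zero b h)
  set ψ := inverseFlow (flow (polynomialBracket b) G)
  have hψ0 : ψ 0 = 1 := by simp [ψ, inverseFlow]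
  have hψ : ∀ y k, (ψ k (linearFunction b y)).IsHomogeneous (k + 1) :=
    fun y k => isHomogeneous_inverseFlow b hG (isHomogeneous_linearFunction b y) k
  have hlin : ∀ (c : ι → 𝕜) (y : ι → 𝔤), ofComponents (fun k => ψ k (linearFunction b
      (∑ i, c i • y i))) = ∑ i, c i • ofComponents (fun k => ψ k (linearFunction b (y i))) := by
    intro c y
    simp only [← map_smul, ← map_sum]
    congr 1
    funext k
    simp
  refine ⟨s, hs, fun i => ofComponents fun k => ψ k (linearFunction b (b i)), ⟨fun i => ?_, ?_⟩,
    fun i j => ?_, fun i => b.repr s i, ?_⟩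
  · rw [← MvPowerSeries.coeff_zero_eq_constantCoeff_apply, coeff_ofComponents]
    exact (hψ (b i) _).coeff_eq_zero (by simp)
  -- As `ψ 0 = 1`, the new coordinates are tangent to the identity and their Jacobian matrix at the
  -- origin is `1`.
  · convert isUnit_one
    rw [← Matrix.det_one (n := ι)]
    congr 1
    ext i j
    simp [coeff_ofComponents, hψ0, coeff_single_linearFunction, Matrix.one_apply,
      Finsupp.single_apply, -linearFunction_basis]
  · rw [poissonBracket_ofComponents b (hψ _) (hψ _),
      seqBracket_inverseFlow _ _ (polynomialBracket_leibniz b), polynomialBracket_apply,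
      hamiltonian_linearFunction, coadjoint_linearFunction, ← hlin]
    simp only [structConst, b.sum_repr, ψ]
  · rw [← hlin, b.sum_repr]
    refine ⟨differentialAtZero_ofComponents b (by rw [hψ0]; rfl), ?_⟩
    conv_lhs => rw [← ofComponents_components h0]
    rw [poissonBracket_ofComponents b (isHomogeneous_components h) (hψ s),
      seqBracket_inverseFlow_eq_zero _ _ (polynomialBracket_leibniz b), map_zero]
    intro k
    rw [polynomialBracket_apply, hamiltonian_skew, hamiltonian_linearFunction, hnorm, neg_zero]

end Assembly

/-! ### Reduction of the analytic case to the formal one. -/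

section Taylor

variable {𝕜 ι : Type*} [RCLike 𝕜] [Fintype ι] [DecidableEq ι]

theorem constantCoeff_taylorSeries (f : (ι → 𝕜) → 𝕜) :
    MvPowerSeries.constantCoeff (taylorSeries f) = f 0 := by
  rw [← MvPowerSeries.coeff_zero_eq_constantCoeff_apply]
  change (∏ i, (((0 : ι →₀ ℕ) i)! : 𝕜))⁻¹ * iteratedPartialDeriv 0 f 0 = f 0
  simp [iteratedPartialDeriv]

end Taylor

end LiePoisson

theorem mainTheorem9 {𝕜 : Type*} [RCLike 𝕜]
    {𝔤 : Type*} [LieRing 𝔤] [LieAlgebra 𝕜 𝔤] [FiniteDimensional 𝕜 𝔤]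
    [LieAlgebra.IsSemisimple 𝕜 𝔤]
    {ι : Type*} [Fintype ι] [DecidableEq ι] (b : Module.Basis ι 𝕜 𝔤) :
    -- formal functions
    (∀ h : MvPowerSeries ι 𝕜, MvPowerSeries.constantCoeff h = 0 →
      LiePoisson.differentialAtZero b h ≠ 0 →
      LiePoisson.AdmitsFormalNormalization b h) ∧
    -- local analytic functions
    (∀ h : Module.Dual 𝕜 𝔤 → 𝕜, AnalyticAt 𝕜 (LiePoisson.inCoordinates b h) 0 →
      h 0 = 0 → fderiv 𝕜 (LiePoisson.inCoordinates b h) 0 ≠ 0 →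
      LiePoisson.AdmitsFormalNormalization b
        (LiePoisson.taylorSeries (LiePoisson.inCoordinates b h))) := by
  have formal : ∀ h : MvPowerSeries ι 𝕜, MvPowerSeries.constantCoeff h = 0 →
      LiePoisson.AdmitsFormalNormalization b h := fun h h0 =>
    let ⟨_, hs⟩ := LiePoisson.exists_isSemisimplePart (LiePoisson.differentialAtZero b h)
    LiePoisson.admitsFormalNormalization_of_isSemisimplePart b h0 hs
  refine ⟨fun h h0 _ => formal h h0, fun h _ h0 _ => formal _ ?_⟩
  rw [LiePoisson.constantCoeff_taylorSeries]
  simpa [LiePoisson.inCoordinates] using h0
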